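/- Max algebra is the semiring of nonnegative reals with addition $a\oplus b=\max(a,b)$ and the usual multiplication; matrix sums, products and powers are taken in this semiring ($A^0=I$). For $A=(a_{ij})\in\mathbb{R}_+^{n\times n}$, an eigenvalue is an $\alpha\ge 0$ with $A\otimes v=\alpha v$ for some nonzero $v\in\mathbb{R}_+^n$. The associated digraph of $A$ has nodes $1,\dots,n$ and an edge $(i,j)$ whenever $a_{ij}>0$. The classes of $A$ are the (node sets of the) strongly connected components of this digraph, a single node always being regarded as strongly connected. The reduced digraph has the classes as nodes and an edge $(\mu,\nu)$ whenever $a_{ij}>0$ for some $i\in\mu$, $j\in\nu$. Write $\mu\to\nu$ if $\mu=\nu$ or there is a path from $\mu$ to $\nu$ in the reduced digraph; the transitive closure of the reduced digraph has the edges $(\mu,\nu)$ with $\mu\to\nu$. The Perron root $\alpha_\mu$ of a class $\mu$ is the maximal cycle geometric mean $$\alpha_\mu=\max_{1\le k\le |\mu|}\ \max_{i_1,\dots,i_k\in\mu}\ (a_{i_1i_2}a_{i_2i_3}\cdots a_{i_ki_1})^{1/k}.$$ A class $\nu$ is initial if $\mu\to\nu$ implies $\mu=\nu$; it is spectral if it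 is initial, or if $\alpha_\nu>0$ and $\mu\to\nu$ implies $\alpha_\mu\le\alpha_\nu$. A max polynomial $p(x_1,\dots,x_r)$ is a polynomial with nonnegative coefficients in which the sum is replaced by the maximum. Theorem. Let $r\ge 1$ and let $A_1,\dots,A_r\in\mathbb{R}_+^{n\times n}$ commute pairwise in max algebra. Suppose that, for each $i$, distinct classes of $A_i$ have distinct Perron roots. Then: (i) All classes of $A_1,\dots,A_r$ and of $A_1\oplus\cdots\oplus A_r$ coincide. (ii) The transitive closures of the reduced digraphs of $A_1,\dots,A_r$ and of $A_1\oplus\cdots\oplus A_r$ coincide. (iii) The spectral classes of $A_1,\dots,A_r$ and of $A_1\oplus\cdots\oplus A_r$ coincide. In particular, $A_1,\dots,A_r$ have the same (finite) number of distinct eigenvalues. (iv) Let $\mu_1,\dots,\mu_m$ be the common spectral classes of $A_1,\dots,A_r$ and let $\alpha_i^j$ be the Perron root of the class $\mu_j$ of $A_i$. Then, for every max polynomial $p(x_1,\dots,x_r)$, the set of eigenvalues of $p(A_1,\dots,A_r)$ is exactly $\{p(\alpha_1^j,\dots,\alpha_r^j) : j=1,\dots,m\}$ (possibly with repetitions among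 these values). -/

import Mathlib

open scoped NNReal

/-- The underlying set of max algebra: the nonnegative real numbers. It is a separate name for
`ℝ≥0` because it carries another addition. -/
def MaxAlg : Type := ℝ≥0

namespace MaxAlg

noncomputable section

instance : LinearOrder MaxAlg := inferInstanceAs (LinearOrder ℝ≥0)

/-- A scalar of max algebra, seen as a nonnegative real number. -/
def toNNReal : MaxAlg ≃ ℝ≥0 := Equiv.refl _

instance : Zero MaxAlg := ⟨toNNReal.symm 0⟩

instance : One MaxAlg := ⟨toNNReal.symm 1⟩

instance : Add MaxAlg := ⟨fun a b => toNNReal.symm (max (toNNReal a) (toNNReal b))⟩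

instance : Mul MaxAlg := ⟨fun a b => toNNReal.symm (toNNReal a * toNNReal b)⟩

/-- Max algebra: the semiring of nonnegative reals in which the sum of `a` and `b` is `max a b`,
the product is the usual product, and zero and one are the usual ones. -/
instance : CommSemiring MaxAlg where
  nsmul := nsmulRec
  add_assoc a b c := max_assoc (toNNReal a) (toNNReal b) (toNNReal c)
  add_comm a b := max_comm (toNNReal a) (toNNReal b)
  zero_add a := max_eq_right (bot_le : (⊥ : ℝ≥0) ≤ toNNReal a)
  add_zero a := max_eq_left (bot_le : (⊥ : ℝ≥0) ≤ toNNReal a)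
  mul_assoc a b c := mul_assoc (toNNReal a) (toNNReal b) (toNNReal c)
  mul_comm a b := mul_comm (toNNReal a) (toNNReal b)
  one_mul a := one_mul (toNNReal a)
  mul_one a := mul_one (toNNReal a)
  zero_mul a := zero_mul (toNNReal a)
  mul_zero a := mul_zero (toNNReal a)
  left_distrib a b c := mul_max (toNNReal a) (toNNReal b) (toNNReal c)
  right_distrib a b c := max_mul (toNNReal a) (toNNReal b) (toNNReal c)

theorem toNNReal_add (a b : MaxAlg) : toNNReal (a + b) = max (toNNReal a) (toNNReal b) := rfl

theorem toNNReal_mul (a b : MaxAlg) : toNNReal (a * b) = toNNReal a * toNNReal b := rfl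

theorem toNNReal_zero : toNNReal 0 = 0 := rfl

theorem toNNReal_one : toNNReal 1 = 1 := rfl

theorem toNNReal_le {a b : MaxAlg} : toNNReal a ≤ toNNReal b ↔ a ≤ b := Iff.rfl

theorem toNNReal_lt {a b : MaxAlg} : toNNReal a < toNNReal b ↔ a < b := Iff.rfl

variable {ι : Type*}

/-- The set of eigenvalues of `A` in max algebra. -/
def eigenvalues [Fintype ι] (A : Matrix ι ι MaxAlg) : Set MaxAlg :=
  {α | ∃ v : ι → MaxAlg, v ≠ 0 ∧ A.mulVec v = α • v}

/-- The maximal cycle geometric mean of `A`: the maximum, over `1 ≤ k ≤ n` (with `n` the size of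
`A`) and over all closed sequences `i₁, …, i_k, i₁` of nodes, of
`(a_{i₁ i₂} ⋯ a_{i_k i₁}) ^ (1 / k)`. -/
def maxCycleMean [Fintype ι] (A : Matrix ι ι MaxAlg) : MaxAlg :=
  toNNReal.symm <|
    (Finset.Icc 1 (Fintype.card ι)).sup fun k =>
      (Finset.univ : Finset (Fin k → ι)).sup fun s =>
        (∏ j : Fin k, toNNReal (A (s j) (s (finRotate k j)))) ^ (1 / (k : ℝ))

/-- `i` has access to `j` in the associated digraph of `A`, whose edges are the pairs `(i, j)`
with `0 < A i j`: there is a path, possibly of length zero, from `i` to `j`. -/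
def NodeAccess (A : Matrix ι ι MaxAlg) : ι → ι → Prop :=
  Relation.ReflTransGen fun i j => 0 < A i j

/-- The classes of `A`: the sets of nodes of the strongly connected components of the associated
digraph of `A`. -/
def classes (A : Matrix ι ι MaxAlg) : Set (Set ι) :=
  {S | ∃ i, S = {j | NodeAccess A i j ∧ NodeAccess A j i}}

/-- The edges of the reduced digraph of `A`, whose nodes are the classes of `A`. -/
def ReducedAdj (A : Matrix ι ι MaxAlg) (μ ν : Set ι) : Prop :=
  μ ∈ classes A ∧ ν ∈ classes A ∧ ∃ i ∈ μ, ∃ j ∈ ν, 0 < A i j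

/-- The edges of the transitive closure of the reduced digraph of `A`: the class `μ` has access to
the class `ν`, that is, `μ = ν` or there is a path from `μ` to `ν` in the reduced digraph. -/
def Access (A : Matrix ι ι MaxAlg) (μ ν : Set ι) : Prop :=
  μ ∈ classes A ∧ ν ∈ classes A ∧ Relation.ReflTransGen (ReducedAdj A) μ ν

open Classical in
/-- The Perron root of a class `μ`: the maximal cycle geometric mean of the submatrix of `A` with
rows and columns in `μ`. -/
def perronRoot [Fintype ι] (A : Matrix ι ι MaxAlg) (μ : Set ι) : MaxAlg :=
  maxCycleMean (A.submatrix (fun i : μ => (i : ι)) (fun i : μ => (i : ι)))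

/-- A class is initial if no other class has access to it. -/
def IsInitial (A : Matrix ι ι MaxAlg) (ν : Set ι) : Prop :=
  ν ∈ classes A ∧ ∀ μ, Access A μ ν → μ = ν

/-- A class `ν` is spectral if it is initial, or if its Perron root is positive and no class with
access to `ν` has a larger Perron root. -/
def IsSpectral [Fintype ι] (A : Matrix ι ι MaxAlg) (ν : Set ι) : Prop :=
  ν ∈ classes A ∧
    (IsInitial A ν ∨
      (0 < perronRoot A ν ∧ ∀ μ, Access A μ ν → perronRoot A μ ≤ perronRoot A ν))

/-- The value of the max polynomial `p` at the square matrices `A 0, …, A (r - 1)`; the factors of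
each monomial are multiplied in this order. A max polynomial is a polynomial with coefficients in
the semiring `MaxAlg`. -/
def evalMatrix [Fintype ι] [DecidableEq ι] {r : ℕ} (p : MvPolynomial (Fin r) MaxAlg)
    (A : Fin r → Matrix ι ι MaxAlg) : Matrix ι ι MaxAlg :=
  ∑ d ∈ p.support, p.coeff d • (List.ofFn fun i => A i ^ d i).prod

end

end MaxAlg

/-!
In max algebra a commuting family has a common eigenvector in every nonzero closed invariant
subsemimodule. An eigenvector of an irreducible matrix is positive, so its eigenvalue is the maximal
cycle mean; hence two irreducible matrices intertwined by a nonzero matrix have the same maximal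
cycle mean.

Let `A` and `B` commute, where distinct classes of `A` have distinct Perron roots. If an edge of `B`
led from one class of `A` to another without respecting access in `A`, then a suitable such edge
would give a nonzero block of `B` intertwining the corresponding diagonal blocks of `A`, which have
different Perron roots. So all the matrices, and also their sum, define the same access relation.

When the Perron roots are distinct, the support of an eigenvector for `c` has a single final class,
and this class is spectral with Perron root `c`; conversely each spectral class arises in this way.
A common eigenvector has the same final class for all the matrices, so a common eigenvector in an
eigenspace of `A k` identifies the spectral classes of the whole family, and one in an eigenspace of
`p(A)` identifies its eigenvalue with the value of `p` at the Perron roots of a spectral class.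
-/

namespace MaxAlg

open Filter Function

open scoped Matrix Topology

noncomputable section

section Scalars

instance : CommGroupWithZero MaxAlg :=
  { (inferInstance : CommMonoidWithZero MaxAlg) with
    inv := fun a => toNNReal.symm (toNNReal a)⁻¹
    exists_pair_ne := ⟨0, 1, zero_ne_one (α := ℝ≥0)⟩
    inv_zero := inv_zero (G₀ := ℝ≥0)
    mul_inv_cancel := fun _ ha => mul_inv_cancel₀ (G₀ := ℝ≥0) ha }

instance : LinearOrderedCommGroupWithZero MaxAlg :=
  { (inferInstance : LinearOrder MaxAlg), (inferInstance : CommGroupWithZero MaxAlg) with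
    bot := 0
    bot_le := fun _ => bot_le (α := ℝ≥0)
    isBot_zero := fun _ => bot_le (α := ℝ≥0)
    mul_lt_mul_of_pos_left := fun _ ha _ _ h => mul_lt_mul_of_pos_left (α := ℝ≥0) h ha }

instance : TopologicalSpace MaxAlg := inferInstanceAs (TopologicalSpace ℝ≥0)

instance : OrderTopology MaxAlg := inferInstanceAs (OrderTopology ℝ≥0)

instance : CompactIccSpace MaxAlg := inferInstanceAs (CompactIccSpace ℝ≥0)

instance : ContinuousMul MaxAlg := inferInstanceAs (ContinuousMul ℝ≥0)

instance : ContinuousAdd MaxAlg := ⟨continuous_max (α := ℝ≥0)⟩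

instance : IsOrderedAddMonoid MaxAlg where
  add_le_add_left _ _ h c := max_le_max_right c h

instance : CanonicallyOrderedAdd MaxAlg where
  exists_add_of_le {_ b} h := ⟨b, (max_eq_right h).symm⟩
  le_add_self a b := le_max_right b a
  le_self_add a b := le_max_left a b

/-- The identity as a multiplicative equivalence: max algebra and `ℝ≥0` differ only in their
addition. -/
def toNNRealMulEquiv : MaxAlg ≃* ℝ≥0 := { toNNReal with map_mul' := toNNReal_mul }

theorem exists_tendsto_of_antitone {f : ℕ → MaxAlg} (hf : Antitone f) :
    ∃ l, Tendsto f atTop (𝓝 l) :=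
  ⟨_, tendsto_atTop_ciInf (α := ℝ≥0) (f := f) hf ⟨0, fun _ _ => bot_le⟩⟩

theorem exists_pow_eq (a : MaxAlg) {k : ℕ} (hk : k ≠ 0) : ∃ b : MaxAlg, b ^ k = a :=
  ⟨toNNRealMulEquiv.symm (toNNRealMulEquiv a ^ (k⁻¹ : ℝ)), toNNRealMulEquiv.injective <| by
    rw [map_pow, MulEquiv.apply_symm_apply, NNReal.rpow_inv_natCast_pow _ hk]⟩

variable {κ : Type*} {s : Finset κ}

theorem sum_le_iff {f : κ → MaxAlg} {c : MaxAlg} : ∑ i ∈ s, f i ≤ c ↔ ∀ i ∈ s, f i ≤ c :=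
  ⟨fun h _ hi => (Finset.single_le_sum_of_canonicallyOrdered hi).trans h,
   fun h => Finset.sum_induction f (· ≤ c) (fun _ _ => max_le) zero_le h⟩

theorem exists_sum_eq (hs : s.Nonempty) (f : κ → MaxAlg) : ∃ i ∈ s, ∑ j ∈ s, f j = f i := by
  obtain ⟨i, hi, hmax⟩ := s.exists_max_image f hs
  exact ⟨i, hi, le_antisymm (sum_le_iff.2 hmax) (sum_le_iff.1 le_rfl i hi)⟩

end Scalars

section Vectors

variable {κ : Type*} [Finite κ]

theorem exists_le_smul_of_support_subset {v x : κ → MaxAlg} (h : support v ⊆ support x) :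
    ∃ c : MaxAlg, v ≤ c • x := by
  have := Fintype.ofFinite κ
  refine ⟨∑ i, v i * (x i)⁻¹, fun i => ?_⟩
  rcases eq_or_ne (x i) 0 with hi | hi
  · simp [notMem_support.1 fun hv => h hv hi]
  · calc v i = v i * (x i)⁻¹ * x i := (inv_mul_cancel_right₀ hi _).symm
      _ ≤ (∑ j, v j * (x j)⁻¹) * x i :=
        mul_le_mul_left (Finset.single_le_sum_of_canonicallyOrdered
          (f := fun j => v j * (x j)⁻¹) (Finset.mem_univ i)) _

theorem exists_mem_forall_support_subset (V : Submodule MaxAlg (κ → MaxAlg)) :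
    ∃ x ∈ V, ∀ v ∈ V, support v ⊆ support x := by
  have := Fintype.ofFinite κ
  have hex : ∀ i, ∃ v ∈ V, (∃ w ∈ V, w i ≠ 0) → v i ≠ 0 := fun i => by
    by_cases h : ∃ w ∈ V, w i ≠ 0
    · obtain ⟨w, hw, hwi⟩ := h
      exact ⟨w, hw, fun _ => hwi⟩
    · exact ⟨0, V.zero_mem, fun h' => absurd h' h⟩
  choose v hv hvi using hex
  refine ⟨∑ i, v i, V.sum_mem fun i _ => hv i, fun w hw i hi => ?_⟩
  have hle : v i ≤ ∑ j, v j := Finset.single_le_sum_of_canonicallyOrdered (Finset.mem_univ i)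
  exact ((pos_iff_ne_zero.2 (hvi i ⟨w, hw, hi⟩)).trans_le (hle i)).ne'

end Vectors

section MulVec

variable {m n : Type*} [Fintype n]

theorem mulVec_le_iff {A : Matrix m n MaxAlg} {v : n → MaxAlg} {i : m} {c : MaxAlg} :
    (A *ᵥ v) i ≤ c ↔ ∀ j, A i j * v j ≤ c := by
  simp only [Matrix.mulVec, dotProduct, sum_le_iff, Finset.mem_univ, true_imp_iff]

theorem mul_le_mulVec (A : Matrix m n MaxAlg) (v : n → MaxAlg) (i : m) (j : n) :
    A i j * v j ≤ (A *ᵥ v) i :=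
  mulVec_le_iff.1 le_rfl j

theorem exists_mulVec_eq [Nonempty n] (A : Matrix m n MaxAlg) (v : n → MaxAlg) (i : m) :
    ∃ j, (A *ᵥ v) i = A i j * v j := by
  obtain ⟨j, -, h⟩ := exists_sum_eq Finset.univ_nonempty fun j => A i j * v j
  exact ⟨j, h⟩

theorem mulVec_pos_iff {A : Matrix m n MaxAlg} {v : n → MaxAlg} {i : m} :
    0 < (A *ᵥ v) i ↔ ∃ j, 0 < A i j ∧ 0 < v j := by
  simp only [← not_le, mulVec_le_iff, not_forall]
  simp [not_or]

theorem mulVec_mono (A : Matrix m n MaxAlg) : Monotone (A *ᵥ ·) := fun _ w h i =>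
  mulVec_le_iff.2 fun j => (mul_le_mul_right (h j) _).trans (mul_le_mulVec A w i j)

theorem continuous_mulVec (A : Matrix m n MaxAlg) : Continuous (A *ᵥ ·) :=
  continuous_const.matrix_mulVec continuous_id

end MulVec

section Eigenvectors

variable {ι : Type*} [Fintype ι]

section FixedVectors

variable [DecidableEq ι] {A : Matrix ι ι MaxAlg} {y : ι → MaxAlg}

theorem antitone_pow_mulVec (hy : A *ᵥ y ≤ y) : Antitone fun k : ℕ => A ^ k *ᵥ y :=
  antitone_nat_of_succ_le fun k => by
    rw [pow_succ, ← Matrix.mulVec_mulVec]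
    exact mulVec_mono _ hy

theorem pow_mulVec_le (hy : A *ᵥ y ≤ y) (k : ℕ) : A ^ k *ᵥ y ≤ y := by
  simpa using antitone_pow_mulVec hy (zero_le (a := k))

theorem exists_tendsto_pow_mulVec (hy : A *ᵥ y ≤ y) :
    ∃ x, Tendsto (fun k : ℕ => A ^ k *ᵥ y) atTop (𝓝 x) ∧ A *ᵥ x = x := by
  choose x hx using fun i => exists_tendsto_of_antitone fun _ _ h => antitone_pow_mulVec hy h i
  have hlim : Tendsto (fun k : ℕ => A ^ k *ᵥ y) atTop (𝓝 x) := tendsto_pi_nhds.2 hx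
  refine ⟨x, hlim, tendsto_nhds_unique ?_ (hlim.comp (tendsto_add_atTop_nat 1))⟩
  refine (((continuous_mulVec A).tendsto x).comp hlim).congr fun k => ?_
  simp only [comp_apply, Matrix.mulVec_mulVec, pow_succ']

theorem exists_smul_pow_mulVec_le_of_tendsto_zero (hy : A *ᵥ y ≤ y)
    (hlim : Tendsto (fun k : ℕ => A ^ k *ᵥ y) atTop (𝓝 0)) :
    ∃ t : MaxAlg, 1 < t ∧ ∃ k : ℕ, k ≠ 0 ∧ (t • A) ^ k *ᵥ y ≤ y := by
  obtain ⟨b, hb⟩ : ∃ b : MaxAlg, 1 < b := ⟨toNNReal.symm 2, one_lt_two (α := ℝ≥0)⟩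
  have hev : ∀ᶠ k : ℕ in atTop, ∀ i, b * (A ^ k *ᵥ y) i ≤ y i := by
    refine eventually_all.2 fun i => ?_
    rcases (zero_le (a := y i)).eq_or_lt with hi | hi
    · exact .of_forall fun k => by
        rw [le_antisymm ((pow_mulVec_le hy k i).trans_eq hi.symm) zero_le, mul_zero]
        exact zero_le
    · have hbi := (tendsto_pi_nhds.1 hlim i).const_mul b
      rw [Pi.zero_apply, mul_zero] at hbi
      exact (hbi.eventually_lt_const hi).mono fun k hk => hk.le
  obtain ⟨k, hk, hk0⟩ := (hev.and (eventually_ne_atTop 0)).exists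
  obtain ⟨t, rfl⟩ := exists_pow_eq b hk0
  refine ⟨t, (one_lt_pow_iff_of_nonneg zero_le hk0).1 hb, k, hk0, ?_⟩
  rw [smul_pow, Matrix.smul_mulVec]
  exact hk

theorem pow_mulVec_mem {V : Submodule MaxAlg (ι → MaxAlg)} (hinv : ∀ v ∈ V, A *ᵥ v ∈ V)
    {x : ι → MaxAlg} (hx : x ∈ V) (k : ℕ) : A ^ k *ᵥ x ∈ V := by
  induction k with
  | zero => simpa using hx
  | succ k ih =>
    rw [pow_succ', ← Matrix.mulVec_mulVec]
    exact hinv _ ih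

/-- The witness is `x + A x + ⋯ + A ^ (k - 1) x`. -/
theorem exists_mulVec_le_of_pow_mulVec_le {V : Submodule MaxAlg (ι → MaxAlg)}
    (hinv : ∀ v ∈ V, A *ᵥ v ∈ V) {x : ι → MaxAlg} (hx : x ∈ V) {k : ℕ} (hk : k ≠ 0)
    (h : A ^ k *ᵥ x ≤ x) : ∃ z ∈ V, x ≤ z ∧ A *ᵥ z ≤ z := by
  set z : ι → MaxAlg := ∑ j ∈ Finset.range k, A ^ j *ᵥ x with hz
  have hle : ∀ j < k, A ^ j *ᵥ x ≤ z := fun j hj =>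
    Finset.single_le_sum_of_canonicallyOrdered (f := fun j => A ^ j *ᵥ x) (Finset.mem_range.2 hj)
  have hxz : x ≤ z := by simpa using hle 0 (Nat.pos_of_ne_zero hk)
  refine ⟨z, V.sum_mem fun j _ => pow_mulVec_mem hinv hx j, hxz, fun i => ?_⟩
  rw [hz, Matrix.mulVec_sum, Finset.sum_apply, sum_le_iff]
  intro j hj
  rw [Matrix.mulVec_mulVec, ← pow_succ']
  rcases (Nat.succ_le_of_lt (Finset.mem_range.1 hj)).eq_or_lt with rfl | hjk
  · exact (h i).trans (hxz i)
  · exact hle _ hjk i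

end FixedVectors

section InvariantSubmodule

variable {A : Matrix ι ι MaxAlg} {V : Submodule MaxAlg (ι → MaxAlg)}

theorem exists_greatest_fixed_le {y : ι → MaxAlg} (hy : A *ᵥ y ≤ y) :
    ∃ x ≤ y, A *ᵥ x = x ∧ ∀ u ≤ y, u ≤ A *ᵥ u → u ≤ x := by
  classical
  obtain ⟨x, hlim, hx⟩ := exists_tendsto_pow_mulVec hy
  refine ⟨x, le_of_tendsto' hlim (pow_mulVec_le hy), hx,
    fun u huy hu => ge_of_tendsto' hlim fun k => ?_⟩
  induction k with
  | zero => simpa using huy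
  | succ k ih =>
    rw [pow_succ', ← Matrix.mulVec_mulVec]
    exact hu.trans (mulVec_mono _ ih)

theorem inv_smul_mulVec_le_iff {c : MaxAlg} (hc : c ≠ 0) {v w : ι → MaxAlg} :
    (c⁻¹ • A) *ᵥ v ≤ w ↔ A *ᵥ v ≤ c • w := by
  rw [Matrix.smul_mulVec, inv_smul_le_iff_of_pos (pos_iff_ne_zero.2 hc)]

theorem exists_greatest_eigenvector_le {c : MaxAlg} (hc : c ≠ 0) {y : ι → MaxAlg}
    (hy : A *ᵥ y ≤ c • y) :
    ∃ x ≤ y, A *ᵥ x = c • x ∧ ∀ u ≤ y, c • u ≤ A *ᵥ u → u ≤ x := by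
  classical
  obtain ⟨x, hxy, hx, hmax⟩ := exists_greatest_fixed_le ((inv_smul_mulVec_le_iff hc).2 hy)
  rw [Matrix.smul_mulVec, inv_smul_eq_iff₀ hc] at hx
  refine ⟨x, hxy, hx, fun u huy hu => hmax u huy ?_⟩
  rwa [Matrix.smul_mulVec, le_inv_smul_iff_of_pos (pos_iff_ne_zero.2 hc)]

theorem exists_mulVec_le_smul (hV : V ≠ ⊥) (hinv : ∀ v ∈ V, A *ᵥ v ∈ V) :
    ∃ x ∈ V, x ≠ 0 ∧ ∃ c : MaxAlg, A *ᵥ x ≤ c • x := by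
  obtain ⟨x, hx, hmax⟩ := exists_mem_forall_support_subset V
  obtain ⟨v, hv, hv0⟩ := V.ne_bot_iff.1 hV
  refine ⟨x, hx, ?_, exists_le_smul_of_support_subset (hmax _ (hinv x hx))⟩
  rintro rfl
  simpa [hv0] using hmax v hv

theorem exists_smul_sum_eq_one {x : ι → MaxAlg} (hx : x ≠ 0) :
    ∃ a : MaxAlg, ∑ i, (a • x) i = 1 := by
  obtain ⟨i, hi⟩ := Function.ne_iff.1 hx
  have hsum : 0 < ∑ i, x i := Finset.sum_pos_iff.2 ⟨i, Finset.mem_univ i, pos_iff_ne_zero.2 hi⟩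
  refine ⟨(∑ i, x i)⁻¹, ?_⟩
  simp only [Pi.smul_apply, smul_eq_mul, ← Finset.mul_sum, inv_mul_cancel₀ hsum.ne']

theorem isCompact_setOf_mulVec_le_smul (A : Matrix ι ι MaxAlg)
    (hclosed : IsClosed (V : Set (ι → MaxAlg))) (b : MaxAlg) :
    IsCompact {p : (ι → MaxAlg) × MaxAlg |
      p.1 ∈ V ∧ ∑ i, p.1 i = 1 ∧ p.2 ≤ b ∧ A *ᵥ p.1 ≤ p.2 • p.1} := by
  refine (isCompact_Icc (a := (0, 0)) (b := (1, b))).of_isClosed_subset ?_ ?_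
  · have hA : Continuous fun p : (ι → MaxAlg) × MaxAlg => A *ᵥ p.1 :=
      (continuous_mulVec A).comp continuous_fst
    exact (hclosed.preimage continuous_fst).inter <|
      (isClosed_eq (by fun_prop) continuous_const).inter <|
      (isClosed_le continuous_snd continuous_const).inter (isClosed_le hA (by fun_prop))
  · rintro ⟨x, d⟩ ⟨-, hx, hd, -⟩
    refine ⟨⟨fun _ => zero_le, zero_le⟩, fun i => ?_, hd⟩
    exact (Finset.single_le_sum_of_canonicallyOrdered (f := x) (Finset.mem_univ i)).trans hx.le

theorem exists_isLeast_mulVec_le_smul (hV : V ≠ ⊥) (hclosed : IsClosed (V : Set (ι → MaxAlg)))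
    (hinv : ∀ v ∈ V, A *ᵥ v ∈ V) :
    ∃ c, IsLeast {c : MaxAlg | ∃ x ∈ V, x ≠ 0 ∧ A *ᵥ x ≤ c • x} c := by
  obtain ⟨x₀, hx₀, hne, b, hb⟩ := exists_mulVec_le_smul hV hinv
  have hnormalize : ∀ x ∈ V, x ≠ 0 → ∀ d ≤ b, A *ᵥ x ≤ d • x →
      ∃ y, y ∈ V ∧ ∑ i, y i = 1 ∧ d ≤ b ∧ A *ᵥ y ≤ d • y := fun x hx hx0 d hd h => by
    obtain ⟨a, ha⟩ := exists_smul_sum_eq_one hx0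
    refine ⟨a • x, V.smul_mem _ hx, ha, hd, ?_⟩
    rw [Matrix.mulVec_smul, smul_comm]
    exact smul_le_smul_of_nonneg_left h zero_le
  obtain ⟨y₀, hy₀⟩ := hnormalize x₀ hx₀ hne b le_rfl hb
  obtain ⟨⟨x, c⟩, ⟨hx, hx1, hcb, hxc⟩, hmin⟩ := (isCompact_setOf_mulVec_le_smul A hclosed b)
    |>.exists_isMinOn ⟨(y₀, b), hy₀⟩ continuous_snd.continuousOn
  refine ⟨c, ⟨x, hx, ?_, hxc⟩, ?_⟩
  · rintro rfl
    simp at hx1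
  · rintro d ⟨y, hy, hy0, hd⟩
    rcases le_total d b with hdb | hbd
    · obtain ⟨z, hz⟩ := hnormalize y hy hy0 d hdb hd
      exact hmin (a := (z, d)) hz
    · exact hcb.trans hbd

theorem exists_eigenvector (hV : V ≠ ⊥) (hclosed : IsClosed (V : Set (ι → MaxAlg)))
    (hinv : ∀ v ∈ V, A *ᵥ v ∈ V) :
    ∃ c : MaxAlg, ∃ x ∈ V, x ≠ 0 ∧ A *ᵥ x = c • x := by
  classical
  obtain ⟨c, ⟨x, hx, hx0, hxc⟩, hmin⟩ := exists_isLeast_mulVec_le_smul hV hclosed hinv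
  refine ⟨c, ?_⟩
  rcases eq_or_ne c 0 with rfl | hc
  · exact ⟨x, hx, hx0, le_antisymm hxc fun i => by simp⟩
  have hx1 := (inv_smul_mulVec_le_iff hc).2 hxc
  have hsmul : ∀ a : MaxAlg, ∀ v ∈ V, (a • A) *ᵥ v ∈ V := fun a v hv => by
    rw [Matrix.smul_mulVec]
    exact V.smul_mem _ (hinv v hv)
  obtain ⟨y, hlim, hy⟩ := exists_tendsto_pow_mulVec hx1
  rw [Matrix.smul_mulVec, inv_smul_eq_iff₀ hc] at hy
  refine ⟨y, hclosed.mem_of_tendsto hlim (.of_forall fun k => ?_), ?_, hy⟩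
  · exact pow_mulVec_mem (hsmul _) hx k
  -- If the limit vanished, `c` could be divided by some `t > 1`.
  rintro rfl
  obtain ⟨t, ht, k, hk, hpow⟩ := exists_smul_pow_mulVec_le_of_tendsto_zero hx1 hlim
  have ht0 : t ≠ 0 := (zero_lt_one.trans ht).ne'
  rw [smul_smul] at hpow
  obtain ⟨z, hz, hxz, hAz⟩ := exists_mulVec_le_of_pow_mulVec_le (hsmul _) hx hk hpow
  rw [← inv_inv t, ← mul_inv_rev,
    inv_smul_mulVec_le_iff (mul_ne_zero hc (inv_ne_zero ht0))] at hAz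
  have hle : c ≤ c * t⁻¹ := hmin ⟨z, hz, fun hz0 => hx0 (le_bot_iff.1 (hxz.trans hz0.le)), hAz⟩
  exact hle.not_gt (mul_lt_of_lt_one_right (pos_iff_ne_zero.2 hc) (inv_lt_one_of_one_lt₀ ht))

end InvariantSubmodule

section CommonEigenvector

variable {A B : Matrix ι ι MaxAlg} {c : MaxAlg}

/-- The eigenvectors of `A` for `c`, together with zero. -/
def eigenspace (A : Matrix ι ι MaxAlg) (c : MaxAlg) : Submodule MaxAlg (ι → MaxAlg) :=
  LinearMap.eqLocus A.mulVecLin (c • LinearMap.id)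

theorem mem_eigenspace {v : ι → MaxAlg} : v ∈ eigenspace A c ↔ A *ᵥ v = c • v := Iff.rfl

theorem isClosed_eigenspace : IsClosed (eigenspace A c : Set (ι → MaxAlg)) :=
  isClosed_eq (continuous_mulVec A) (continuous_const_smul c)

theorem mulVec_mem_eigenspace (h : A * B = B * A) {v : ι → MaxAlg} (hv : v ∈ eigenspace A c) :
    B *ᵥ v ∈ eigenspace A c := by
  rw [mem_eigenspace] at hv ⊢
  rw [Matrix.mulVec_mulVec, h, ← Matrix.mulVec_mulVec, hv, Matrix.mulVec_smul]

theorem exists_common_eigenvector {κ : Type*} [Finite κ] {A : κ → Matrix ι ι MaxAlg}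
    (hcomm : ∀ i j, A i * A j = A j * A i) {V : Submodule MaxAlg (ι → MaxAlg)} (hV : V ≠ ⊥)
    (hclosed : IsClosed (V : Set (ι → MaxAlg))) (hinv : ∀ i, ∀ v ∈ V, A i *ᵥ v ∈ V) :
    ∃ x ∈ V, x ≠ 0 ∧ ∃ c : κ → MaxAlg, ∀ i, A i *ᵥ x = c i • x := by
  classical
  have := Fintype.ofFinite κ
  have key : ∀ s : Finset κ, ∃ W ≤ V, W ≠ ⊥ ∧ IsClosed (W : Set (ι → MaxAlg)) ∧
      (∀ i, ∀ v ∈ W, A i *ᵥ v ∈ W) ∧ ∀ i ∈ s, ∃ c, W ≤ eigenspace (A i) c := fun s => by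
    induction s using Finset.induction_on with
    | empty => exact ⟨V, le_rfl, hV, hclosed, hinv, by simp⟩
    | insert a s _ ih =>
      obtain ⟨W, hWV, hW, hWclosed, hWinv, hWs⟩ := ih
      obtain ⟨c, x, hx, hx0, hxc⟩ := exists_eigenvector hW hWclosed (hWinv a)
      refine ⟨W ⊓ eigenspace (A a) c, inf_le_left.trans hWV,
        (Submodule.ne_bot_iff _).2 ⟨x, ⟨hx, hxc⟩, hx0⟩, hWclosed.inter isClosed_eigenspace,
        fun i v hv => ⟨hWinv i v hv.1, mulVec_mem_eigenspace (hcomm a i) hv.2⟩, fun i hi => ?_⟩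
      rcases Finset.mem_insert.1 hi with rfl | hi
      · exact ⟨c, inf_le_right⟩
      · exact (hWs i hi).imp fun _ => inf_le_left.trans
  obtain ⟨W, hWV, hW, -, -, heig⟩ := key Finset.univ
  obtain ⟨x, hx, hx0⟩ := W.ne_bot_iff.1 hW
  choose c hc using fun i => heig i (Finset.mem_univ i)
  exact ⟨x, hWV hx, hx0, c, fun i => hc i hx⟩

end CommonEigenvector

end Eigenvectors

section CycleMean

variable {ι : Type*}

theorem prod_cycle_mul_prod (A : Matrix ι ι MaxAlg) (z : ι → MaxAlg) {k : ℕ} (s : Fin k → ι) :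
    (∏ j, A (s j) (s (finRotate k j))) * ∏ j, z (s j) =
      ∏ j, A (s j) (s (finRotate k j)) * z (s (finRotate k j)) := by
  rw [Finset.prod_mul_distrib, Equiv.prod_comp (finRotate k) fun j => z (s j)]

variable {A : Matrix ι ι MaxAlg} {c : MaxAlg} {z : ι → MaxAlg}

theorem prod_cycle_le_pow (hz : ∀ i, 0 < z i) (h : ∀ i j, A i j * z j ≤ c * z i) {k : ℕ}
    (s : Fin k → ι) : ∏ j, A (s j) (s (finRotate k j)) ≤ c ^ k := by
  refine le_of_mul_le_mul_right ?_ (Finset.prod_pos (s := .univ) fun j _ => hz (s j))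
  calc (∏ j, A (s j) (s (finRotate k j))) * ∏ j, z (s j)
      = ∏ j, A (s j) (s (finRotate k j)) * z (s (finRotate k j)) := prod_cycle_mul_prod A z s
    _ ≤ ∏ j, c * z (s j) := Finset.prod_le_prod (fun _ _ => zero_le) fun _ _ => h _ _
    _ = c ^ k * ∏ j, z (s j) := by simp [Finset.prod_mul_distrib]

theorem pow_le_prod_cycle (hz : ∀ i, 0 < z i) {k : ℕ} {s : Fin k → ι}
    (h : ∀ j, c * z (s j) ≤ A (s j) (s (finRotate k j)) * z (s (finRotate k j))) :
    c ^ k ≤ ∏ j, A (s j) (s (finRotate k j)) := by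
  refine le_of_mul_le_mul_right ?_ (Finset.prod_pos (s := .univ) fun j _ => hz (s j))
  calc c ^ k * ∏ j, z (s j) = ∏ j, c * z (s j) := by simp [Finset.prod_mul_distrib]
    _ ≤ ∏ j, A (s j) (s (finRotate k j)) * z (s (finRotate k j)) :=
      Finset.prod_le_prod (fun _ _ => zero_le) fun j _ => h j
    _ = (∏ j, A (s j) (s (finRotate k j))) * ∏ j, z (s j) := (prod_cycle_mul_prod A z s).symm

theorem periodicPts_nonempty {α : Type*} [Finite α] [Nonempty α] (f : α → α) :
    (periodicPts f).Nonempty := by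
  obtain ⟨a⟩ := ‹Nonempty α›
  obtain ⟨m, n, hmn, h⟩ := Set.finite_univ.exists_lt_map_eq_of_forall_mem
    (f := fun n : ℕ => f^[n] a) fun _ => Set.mem_univ _
  refine ⟨f^[m] a, n - m, Nat.sub_pos_of_lt hmn, ?_⟩
  rw [IsPeriodicPt, IsFixedPt, ← iterate_add_apply, Nat.sub_add_cancel hmn.le, h]

theorem iterate_finRotate (f : ι → ι) {p : ι} {k : ℕ} (hp : f^[k] p = p) (j : Fin k) :
    f^[finRotate k j] p = f (f^[j] p) := by
  cases k with
  | zero => exact j.elim0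
  | succ k =>
    rw [← iterate_succ_apply' f, coe_finRotate]
    split_ifs with hj
    · rw [hj, Fin.val_last, hp, iterate_zero_apply]
    · rfl

variable [Fintype ι]

theorem maxCycleMean_le_iff : maxCycleMean A ≤ c ↔ ∀ k, 1 ≤ k → k ≤ Fintype.card ι →
    ∀ s : Fin k → ι, ∏ j, A (s j) (s (finRotate k j)) ≤ c ^ k := by
  have hprod : ∀ (k : ℕ) (f : Fin k → MaxAlg), toNNReal (∏ j, f j) = ∏ j, toNNReal (f j) :=
    fun k f => map_prod toNNRealMulEquiv f _
  rw [← toNNReal_le, maxCycleMean, Equiv.apply_symm_apply, Finset.sup_le_iff]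
  simp only [Finset.mem_Icc, and_imp, Finset.sup_le_iff, Finset.mem_univ, true_imp_iff]
  refine forall₄_congr fun k hk _ s => ?_
  rw [one_div, NNReal.rpow_inv_le_iff (by exact_mod_cast hk), NNReal.rpow_natCast, ← hprod]
  exact Iff.of_eq (congrArg (_ ≤ ·) (map_pow toNNRealMulEquiv c k).symm)

theorem maxCycleMean_le (hz : ∀ i, 0 < z i) (h : ∀ i j, A i j * z j ≤ c * z i) :
    maxCycleMean A ≤ c :=
  maxCycleMean_le_iff.2 fun _ _ _ s => prod_cycle_le_pow hz h s

/-- Following the edges on which the inequality holds eventually runs through a cycle. -/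
theorem le_maxCycleMean [Nonempty ι] (hz : ∀ i, 0 < z i)
    (h : ∀ i, ∃ j, c * z i ≤ A i j * z j) : c ≤ maxCycleMean A := by
  choose f hf using h
  obtain ⟨p, hp⟩ := periodicPts_nonempty f
  have hpos : 0 < minimalPeriod f p := minimalPeriod_pos_of_mem_periodicPts hp
  let s : Fin (minimalPeriod f p) → ι := fun j => f^[j] p
  have hs : ∀ j, s (finRotate _ j) = f (s j) := iterate_finRotate f iterate_minimalPeriod
  have hcycle : c ^ minimalPeriod f p ≤ maxCycleMean A ^ minimalPeriod f p :=
    (pow_le_prod_cycle hz fun j => (hs j).symm ▸ hf (s j)).trans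
      (maxCycleMean_le_iff.1 le_rfl _ hpos minimalPeriod_le_card s)
  exact le_of_pow_le_pow_left₀ hpos.ne' zero_le hcycle

theorem maxCycleMean_eq_of_eigenvector [Nonempty ι] (hz : ∀ i, 0 < z i) (h : A *ᵥ z = c • z) :
    maxCycleMean A = c := by
  refine le_antisymm (maxCycleMean_le hz fun i j => ?_) (le_maxCycleMean hz fun i => ?_)
  · exact (mul_le_mulVec A z i j).trans_eq (congrFun h i)
  · exact (exists_mulVec_eq A z i).imp fun j hj => ((congrFun h i).symm.trans hj).le

theorem perronRoot_le {S : Set ι} (hz : ∀ i ∈ S, 0 < z i)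
    (h : ∀ i ∈ S, ∀ j ∈ S, A i j * z j ≤ c * z i) : perronRoot A S ≤ c := by
  classical
  exact maxCycleMean_le (z := fun i : S => z i) (fun i => hz i i.2) fun i j => h i i.2 j j.2

theorem le_perronRoot {S : Set ι} (hS : S.Nonempty) (hz : ∀ i ∈ S, 0 < z i)
    (h : ∀ i ∈ S, ∃ j ∈ S, c * z i ≤ A i j * z j) : c ≤ perronRoot A S := by
  classical
  have := hS.to_subtype
  refine le_maxCycleMean (z := fun i : S => z i) (fun i => hz i i.2) fun i => ?_
  obtain ⟨j, hj, hij⟩ := h i i.2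
  exact ⟨⟨j, hj⟩, hij⟩

end CycleMean

section Classes

variable {ι : Type*} {A B : Matrix ι ι MaxAlg} {i j k : ι}

/-- The class of the node `i`. -/
def nodeClass (A : Matrix ι ι MaxAlg) (i : ι) : Set ι :=
  {j | NodeAccess A i j ∧ NodeAccess A j i}

theorem NodeAccess.trans (h : NodeAccess A i j) (h' : NodeAccess A j k) : NodeAccess A i k :=
  Relation.ReflTransGen.trans h h'

theorem NodeAccess.of_pos (h : 0 < A i j) : NodeAccess A i j := Relation.ReflTransGen.single h

theorem self_mem_nodeClass (i : ι) : i ∈ nodeClass A i := ⟨.refl, .refl⟩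

theorem nodeClass_mem_classes (i : ι) : nodeClass A i ∈ classes A := ⟨i, rfl⟩

theorem nodeClass_eq_iff :
    nodeClass A i = nodeClass A j ↔ NodeAccess A i j ∧ NodeAccess A j i := by
  refine ⟨fun h => ((h ▸ self_mem_nodeClass i : i ∈ nodeClass A j)).symm, fun ⟨hij, hji⟩ => ?_⟩
  ext k
  exact ⟨fun hk => ⟨hji.trans hk.1, hk.2.trans hij⟩, fun hk => ⟨hij.trans hk.1, hk.2.trans hji⟩⟩

theorem nodeClass_eq_of_mem (h : j ∈ nodeClass A i) : nodeClass A j = nodeClass A i :=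
  nodeClass_eq_iff.2 h.symm

theorem nodeClass_congr (h : NodeAccess A = NodeAccess B) : nodeClass A = nodeClass B := by
  unfold nodeClass
  rw [h]

theorem classes_congr (h : NodeAccess A = NodeAccess B) : classes A = classes B := by
  unfold classes
  rw [h]

theorem nodeAccess_eq_of_edges (hAB : ∀ i j, 0 < A i j → NodeAccess B i j)
    (hBA : ∀ i j, 0 < B i j → NodeAccess A i j) : NodeAccess A = NodeAccess B := by
  ext i j
  exact ⟨Relation.ReflTransGen.lift' id hAB i j, Relation.ReflTransGen.lift' id hBA i j⟩

theorem access_nodeClass_iff :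
    Access A (nodeClass A i) (nodeClass A j) ↔ NodeAccess A i j := by
  constructor
  · rintro ⟨-, -, h⟩
    generalize hν : nodeClass A j = ν at h
    suffices hall : ∀ k ∈ ν, NodeAccess A i k from hall j (hν ▸ self_mem_nodeClass j)
    clear hν
    induction h with
    | refl => exact fun k hk => hk.1
    | tail _ hadj ih =>
      obtain ⟨-, ⟨m, rfl⟩, p, hp, q, hq, hpq⟩ := hadj
      exact fun k hk => (ih p hp).trans ((NodeAccess.of_pos hpq).trans (hq.2.trans hk.1))
  · intro h
    refine ⟨nodeClass_mem_classes i, nodeClass_mem_classes j, ?_⟩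
    induction h with
    | refl => exact .refl
    | @tail b c _ hbc ih =>
      exact ih.tail ⟨nodeClass_mem_classes b, nodeClass_mem_classes c, b, self_mem_nodeClass b,
        c, self_mem_nodeClass c, hbc⟩

theorem access_iff {μ ν : Set ι} :
    Access A μ ν ↔ ∃ i j, μ = nodeClass A i ∧ ν = nodeClass A j ∧ NodeAccess A i j := by
  constructor
  · intro h
    obtain ⟨i, rfl⟩ := h.1
    obtain ⟨j, rfl⟩ := h.2.1
    exact ⟨i, j, rfl, rfl, access_nodeClass_iff.1 h⟩
  · rintro ⟨i, j, rfl, rfl, h⟩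
    exact access_nodeClass_iff.2 h

theorem access_congr (h : NodeAccess A = NodeAccess B) : Access A = Access B := by
  ext μ ν
  rw [access_iff, access_iff, nodeClass_congr h, h]

theorem isInitial_congr (h : NodeAccess A = NodeAccess B) : IsInitial A = IsInitial B := by
  unfold IsInitial
  rw [classes_congr h, access_congr h]

end Classes

section Height

variable {ι : Type*} [Finite ι] {A : Matrix ι ι MaxAlg} {i j : ι}

/-- The number of nodes to which `i` has access; it is constant on classes and drops strictly
along the edges between them. -/
def height (A : Matrix ι ι MaxAlg) (i : ι) : ℕ := {l | NodeAccess A i l}.ncard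

theorem height_le (h : NodeAccess A i j) : height A j ≤ height A i :=
  Set.ncard_le_ncard fun _ hl => h.trans hl

theorem nodeAccess_of_height_le (h : NodeAccess A i j) (hle : height A i ≤ height A j) :
    NodeAccess A j i := by
  have heq : {l | NodeAccess A j l} = {l | NodeAccess A i l} :=
    Set.eq_of_subset_of_ncard_le (fun _ hl => h.trans hl) hle
  exact (Set.ext_iff.1 heq i).2 .refl

end Height

section Irreducible

variable {ι : Type*}

/-- A matrix is irreducible if its associated digraph is strongly connected. -/
def IsIrreducible (A : Matrix ι ι MaxAlg) : Prop := ∀ i j, NodeAccess A i j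

variable [Fintype ι] {A : Matrix ι ι MaxAlg} {c : MaxAlg} {v : ι → MaxAlg}

theorem pos_of_nodeAccess (hv : A *ᵥ v = c • v) {i j : ι} (h : NodeAccess A i j)
    (hj : 0 < v j) : 0 < v i := by
  induction h using Relation.ReflTransGen.head_induction_on with
  | refl => exact hj
  | @head i k hik _ hk =>
    have hpos : 0 < (A *ᵥ v) i := mulVec_pos_iff.2 ⟨k, hik, hk⟩
    rw [hv] at hpos
    exact pos_iff_ne_zero.2 (right_ne_zero_of_mul hpos.ne')

theorem IsIrreducible.pos_of_eigenvector (hA : IsIrreducible A) (hv0 : v ≠ 0)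
    (hv : A *ᵥ v = c • v) (i : ι) : 0 < v i := by
  obtain ⟨j, hj⟩ := Function.ne_iff.1 hv0
  exact pos_of_nodeAccess hv (hA i j) (pos_iff_ne_zero.2 hj)

theorem IsIrreducible.maxCycleMean_eq (hA : IsIrreducible A) (hv0 : v ≠ 0)
    (hv : A *ᵥ v = c • v) : maxCycleMean A = c := by
  obtain ⟨j, -⟩ := Function.ne_iff.1 hv0
  have : Nonempty ι := ⟨j⟩
  exact maxCycleMean_eq_of_eigenvector (hA.pos_of_eigenvector hv0 hv) hv

theorem exists_common_perron_vector [Nonempty ι] {κ : Type*} [Finite κ]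
    {A : κ → Matrix ι ι MaxAlg} (hcomm : ∀ k l, A k * A l = A l * A k)
    (hA : ∀ k, IsIrreducible (A k)) :
    ∃ u : ι → MaxAlg, u ≠ 0 ∧ ∀ k, A k *ᵥ u = maxCycleMean (A k) • u := by
  obtain ⟨u, -, hu0, c, hc⟩ := exists_common_eigenvector hcomm (V := ⊤) top_ne_bot
    isClosed_univ fun _ _ _ => Submodule.mem_top
  exact ⟨u, hu0, fun k => (hA k).maxCycleMean_eq hu0 (hc k) ▸ hc k⟩

theorem IsIrreducible.exists_perron_vector [Nonempty ι] (hA : IsIrreducible A) :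
    ∃ u : ι → MaxAlg, (∀ i, 0 < u i) ∧ A *ᵥ u = maxCycleMean A • u := by
  obtain ⟨u, hu0, hu⟩ := exists_common_perron_vector (A := fun _ : Unit => A) (fun _ _ => rfl)
    fun _ => hA
  exact ⟨u, hA.pos_of_eigenvector hu0 (hu ()), hu ()⟩

theorem maxCycleMean_sum [Nonempty ι] {κ : Type*} [Fintype κ] {A : κ → Matrix ι ι MaxAlg}
    (hcomm : ∀ k l, A k * A l = A l * A k) (hA : ∀ k, IsIrreducible (A k))
    (hsum : IsIrreducible (∑ k, A k)) : maxCycleMean (∑ k, A k) = ∑ k, maxCycleMean (A k) := by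
  obtain ⟨u, hu0, hu⟩ := exists_common_perron_vector hcomm hA
  refine hsum.maxCycleMean_eq hu0 ?_
  rw [Matrix.sum_mulVec, Finset.sum_smul]
  exact Finset.sum_congr rfl fun k _ => hu k

/-- `X` maps a Perron vector of `B` to an eigenvector of `A`. -/
theorem maxCycleMean_eq_of_intertwining {m : Type*} [Fintype m] {B : Matrix m m MaxAlg}
    (hA : IsIrreducible A) (hB : IsIrreducible B) {X : Matrix ι m MaxAlg} (hX : X ≠ 0)
    (h : A * X = X * B) : maxCycleMean A = maxCycleMean B := by
  obtain ⟨i, hi⟩ := Function.ne_iff.1 hX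
  obtain ⟨j, hij⟩ := Function.ne_iff.1 hi
  have : Nonempty m := ⟨j⟩
  obtain ⟨u, hupos, hu⟩ := hB.exists_perron_vector
  have hXu : 0 < (X *ᵥ u) i := mulVec_pos_iff.2 ⟨j, pos_iff_ne_zero.2 hij, hupos j⟩
  refine hA.maxCycleMean_eq (v := X *ᵥ u) (fun h0 => hXu.ne' (congrFun h0 i)) ?_
  rw [Matrix.mulVec_mulVec, h, ← Matrix.mulVec_mulVec, hu, Matrix.mulVec_smul]

end Irreducible

section Block

variable {ι : Type*} {A : Matrix ι ι MaxAlg}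

/-- The block of `A` with rows in `S` and columns in `T`. -/
abbrev block (A : Matrix ι ι MaxAlg) (S T : Set ι) : Matrix S T MaxAlg :=
  A.submatrix (↑) (↑)

theorem block_sum {κ : Type*} [Fintype κ] (A : κ → Matrix ι ι MaxAlg) (S T : Set ι) :
    block (∑ k, A k) S T = ∑ k, block (A k) S T := by
  ext i j
  simp only [Matrix.submatrix_apply, Matrix.sum_apply]

theorem block_mul_block [Fintype ι] {A B : Matrix ι ι MaxAlg} {S R T : Set ι} [Fintype R]
    (h : ∀ i ∈ S, ∀ j ∈ T, ∀ m, 0 < A i m → 0 < B m j → m ∈ R) :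
    block A S R * block B R T = block (A * B) S T := by
  ext ⟨i, hi⟩ ⟨j, hj⟩
  refine Fintype.sum_of_injective (↑) Subtype.val_injective _ _ (fun m hm => ?_) fun _ => rfl
  by_contra h0
  refine hm ⟨⟨m, h i hi j hj m ?_ ?_⟩, rfl⟩
  · exact pos_iff_ne_zero.2 (left_ne_zero_of_mul h0)
  · exact pos_iff_ne_zero.2 (right_ne_zero_of_mul h0)

theorem isIrreducible_block {μ : Set ι} (hμ : μ ∈ classes A) : IsIrreducible (block A μ μ) := by
  obtain ⟨q, rfl⟩ := hμ
  rintro ⟨i, hi⟩ ⟨j, hj⟩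
  have hij : NodeAccess A i j := hi.2.trans hj.1
  induction hij using Relation.ReflTransGen.head_induction_on with
  | refl => exact .refl
  | @head i k hik hkj ih =>
    have hk : k ∈ nodeClass A q := ⟨hi.1.trans (.of_pos hik), NodeAccess.trans hkj hj.2⟩
    exact .head (show 0 < block A _ _ ⟨i, hi⟩ ⟨k, hk⟩ from hik) (ih hk)

theorem nonempty_of_mem_classes {μ : Set ι} (hμ : μ ∈ classes A) : Nonempty μ := by
  obtain ⟨q, rfl⟩ := hμ
  exact ⟨⟨q, self_mem_nodeClass q⟩⟩

theorem nodeAccess_sum_eq {κ : Type*} [Fintype κ] {A : κ → Matrix ι ι MaxAlg}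
    (hA : ∀ k l, NodeAccess (A k) = NodeAccess (A l)) (k : κ) :
    NodeAccess (∑ l, A l) = NodeAccess (A k) := by
  refine nodeAccess_eq_of_edges (fun i j hij => ?_) fun i j hij => .of_pos ?_
  · rw [Matrix.sum_apply, Finset.sum_pos_iff] at hij
    obtain ⟨l, -, hl⟩ := hij
    exact hA l k ▸ NodeAccess.of_pos hl
  · rw [Matrix.sum_apply, Finset.sum_pos_iff]
    exact ⟨k, Finset.mem_univ k, hij⟩

theorem perronRoot_sum [Fintype ι] {κ : Type*} [Fintype κ] {A : κ → Matrix ι ι MaxAlg}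
    (hcomm : ∀ k l, A k * A l = A l * A k) (hA : ∀ k l, NodeAccess (A k) = NodeAccess (A l))
    {k₀ : κ} {μ : Set ι} (hμ : μ ∈ classes (A k₀)) :
    perronRoot (∑ k, A k) μ = ∑ k, perronRoot (A k) μ := by
  classical
  have := nonempty_of_mem_classes hμ
  have hμk : ∀ k, μ ∈ classes (A k) := fun k => classes_congr (hA k₀ k) ▸ hμ
  have hμsum : μ ∈ classes (∑ k, A k) := classes_congr (nodeAccess_sum_eq hA k₀) ▸ hμ
  have hmul : ∀ k l, block (A k) μ μ * block (A l) μ μ = block (A k * A l) μ μ := fun k l =>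
    block_mul_block fun i hi j hj m him hmj => by
      obtain ⟨q, rfl⟩ := hμk k
      have hmj' : NodeAccess (A k) m j := hA l k ▸ NodeAccess.of_pos hmj
      exact ⟨hi.1.trans (.of_pos him), hmj'.trans hj.2⟩
  have hblock : maxCycleMean (∑ k, block (A k) μ μ) = ∑ k, maxCycleMean (block (A k) μ μ) :=
    maxCycleMean_sum (fun k l => by rw [hmul, hmul, hcomm])
      (fun k => isIrreducible_block (hμk k)) (block_sum A μ μ ▸ isIrreducible_block hμsum)
  rwa [← block_sum] at hblock

/-- Among the edges `(p, q)` of `B` that violate the claim, choose one with the smallest height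
difference. Then the blocks of `A` at the classes of `p` and `q` are intertwined by a nonzero block
of `B`, so these two classes have the same Perron root. -/
theorem nodeAccess_of_commute [Fintype ι] {A B : Matrix ι ι MaxAlg}
    (hdist : Set.InjOn (perronRoot A) (classes A)) (hcomm : A * B = B * A) {i j : ι}
    (hij : 0 < B i j) : NodeAccess A i j := by
  classical
  by_contra hbad
  obtain ⟨⟨p, q⟩, ⟨hpq, hnot⟩, hmin⟩ := Set.exists_min_image
    {e : ι × ι | 0 < B e.1 e.2 ∧ ¬ NodeAccess A e.1 e.2}
    (fun e => (height A e.1 : ℤ) - height A e.2) (Set.toFinite _) ⟨(i, j), hij, hbad⟩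
  simp only [Set.mem_ofPred_eq, Prod.forall, and_imp] at hpq hnot hmin
  have hleft : block A (nodeClass A p) (nodeClass A p) * block B (nodeClass A p) (nodeClass A q) =
      block (A * B) (nodeClass A p) (nodeClass A q) :=
    block_mul_block fun k hk l hl m hkm hml => by
      have hpm : NodeAccess A p m := hk.1.trans (.of_pos hkm)
      have hmin' := hmin m l hml fun h => hnot (hpm.trans (h.trans hl.2))
      have hlq := height_le hl.2
      exact ⟨hpm, nodeAccess_of_height_le hpm (by omega)⟩
  have hright : block B (nodeClass A p) (nodeClass A q) * block A (nodeClass A q) (nodeClass A q) =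
      block (B * A) (nodeClass A p) (nodeClass A q) :=
    block_mul_block fun k hk l hl m hkm hml => by
      have hmq : NodeAccess A m q := (NodeAccess.of_pos hml).trans hl.2
      have hmin' := hmin k m hkm fun h => hnot (hk.1.trans (h.trans hmq))
      have hkp := height_le hk.1
      exact ⟨nodeAccess_of_height_le hmq (by omega), hmq⟩
  have hroot : perronRoot A (nodeClass A p) = perronRoot A (nodeClass A q) :=
    maxCycleMean_eq_of_intertwining (isIrreducible_block (nodeClass_mem_classes p))
      (isIrreducible_block (nodeClass_mem_classes q))
      (fun h => hpq.ne' (congrFun₂ h ⟨p, self_mem_nodeClass p⟩ ⟨q, self_mem_nodeClass q⟩))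
      (hleft.trans (hcomm ▸ hright.symm))
  exact hnot (nodeClass_eq_iff.1
    (hdist (nodeClass_mem_classes p) (nodeClass_mem_classes q) hroot)).1

end Block

section Spectral

variable {ι : Type*} [Fintype ι] {A : Matrix ι ι MaxAlg} {c : MaxAlg} {v : ι → MaxAlg} {q : ι}

theorem isSpectral_nodeClass_iff : IsSpectral A (nodeClass A q) ↔
    IsInitial A (nodeClass A q) ∨ 0 < perronRoot A (nodeClass A q) ∧
      ∀ i, NodeAccess A i q → perronRoot A (nodeClass A i) ≤ perronRoot A (nodeClass A q) := by
  refine (and_iff_right (nodeClass_mem_classes q)).trans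
    (or_congr_right (and_congr_right fun _ => ⟨fun h i hi => h _ (access_nodeClass_iff.2 hi), ?_⟩))
  rintro h μ hμ
  obtain ⟨i, rfl⟩ := hμ.1
  exact h i (access_nodeClass_iff.1 hμ)

theorem perronRoot_le_of_eigenvector (hv : A *ᵥ v = c • v) {i : ι} (hi : 0 < v i) :
    perronRoot A (nodeClass A i) ≤ c :=
  perronRoot_le (z := v) (fun _ hj => pos_of_nodeAccess hv hj.2 hi) fun j _ l _ =>
    (mul_le_mulVec A v j l).trans_eq (congrFun hv j)

theorem exists_nodeAccess_perronRoot_eq (hv : A *ᵥ v = c • v) {j : ι} (hj : 0 < v j) :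
    ∃ m, NodeAccess A j m ∧ 0 < v m ∧ perronRoot A (nodeClass A m) = c := by
  obtain ⟨m, ⟨hjm, hm⟩, hmin⟩ := Set.exists_min_image {m | NodeAccess A j m ∧ 0 < v m} (height A)
    (Set.toFinite _) ⟨j, .refl, hj⟩
  refine ⟨m, hjm, hm, le_antisymm (perronRoot_le_of_eigenvector hv hm) ?_⟩
  rcases eq_or_ne c 0 with rfl | hc
  · exact zero_le
  have hpos : ∀ i ∈ nodeClass A m, 0 < v i := fun i hi => pos_of_nodeAccess hv hi.2 hm
  refine le_perronRoot ⟨m, self_mem_nodeClass m⟩ hpos fun i hi => ?_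
  have : Nonempty ι := ⟨m⟩
  obtain ⟨l, hl⟩ := exists_mulVec_eq A v i
  rw [hv, Pi.smul_apply, smul_eq_mul] at hl
  have hne : A i l * v l ≠ 0 := hl ▸ mul_ne_zero hc (hpos i hi).ne'
  have hml : NodeAccess A m l := hi.1.trans (.of_pos (pos_iff_ne_zero.2 (left_ne_zero_of_mul hne)))
  have hle := hmin l ⟨hjm.trans hml, pos_iff_ne_zero.2 (right_ne_zero_of_mul hne)⟩
  exact ⟨l, ⟨hml, nodeAccess_of_height_le hml hle⟩, hl.le⟩

theorem exists_final_node (hdist : Set.InjOn (perronRoot A) (classes A)) (hv0 : v ≠ 0)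
    (hv : A *ᵥ v = c • v) :
    ∃ q, 0 < v q ∧ perronRoot A (nodeClass A q) = c ∧ ∀ i, 0 < v i → NodeAccess A i q := by
  obtain ⟨j, hj⟩ := Function.ne_iff.1 hv0
  obtain ⟨q, -, hq, hroot⟩ := exists_nodeAccess_perronRoot_eq hv (pos_iff_ne_zero.2 hj)
  refine ⟨q, hq, hroot, fun i hi => ?_⟩
  obtain ⟨m, him, -, hm⟩ := exists_nodeAccess_perronRoot_eq hv hi
  have hmq := hdist (nodeClass_mem_classes m) (nodeClass_mem_classes q) (hm.trans hroot.symm)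
  exact him.trans (nodeClass_eq_iff.1 hmq).1

theorem isSpectral_of_eigenvector (hdist : Set.InjOn (perronRoot A) (classes A))
    (hv : A *ᵥ v = perronRoot A (nodeClass A q) • v) (hq : 0 < v q) :
    IsSpectral A (nodeClass A q) := by
  have hle : ∀ i, NodeAccess A i q →
      perronRoot A (nodeClass A i) ≤ perronRoot A (nodeClass A q) := fun i hi =>
    perronRoot_le_of_eigenvector hv (pos_of_nodeAccess hv hi hq)
  rw [isSpectral_nodeClass_iff]
  rcases (zero_le (a := perronRoot A (nodeClass A q))).eq_or_lt with h0 | hpos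
  · refine .inl ⟨nodeClass_mem_classes q, fun μ hμ => ?_⟩
    obtain ⟨i, rfl⟩ := hμ.1
    refine hdist (nodeClass_mem_classes i) (nodeClass_mem_classes q) ?_
    exact le_antisymm (hle i (access_nodeClass_iff.1 hμ)) (h0 ▸ zero_le)
  · exact .inr ⟨hpos, hle⟩

/-- `w` is positive, and its restriction to each class of `A` is an eigenvector of the
corresponding diagonal block for the Perron root of the class. Eigenvectors of `A` for the spectral
classes are built from such vectors. -/
structure IsClasswisePerron (A : Matrix ι ι MaxAlg) (w : ι → MaxAlg) : Prop where
  pos : ∀ i, 0 < w i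
  mul_le : ∀ i, ∀ l ∈ nodeClass A i, A i l * w l ≤ perronRoot A (nodeClass A i) * w i
  exists_le : ∀ i, ∃ l ∈ nodeClass A i, perronRoot A (nodeClass A i) * w i ≤ A i l * w l

variable (A) in
theorem exists_isClasswisePerron : ∃ w, IsClasswisePerron A w := by
  classical
  have hblock : ∀ μ ∈ classes A, ∃ u : μ → MaxAlg, (∀ i, 0 < u i) ∧
      block A μ μ *ᵥ u = perronRoot A μ • u := fun μ hμ => by
    have := nonempty_of_mem_classes hμ
    exact (isIrreducible_block hμ).exists_perron_vector
  choose u hupos hu using hblock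
  let w : ι → MaxAlg := fun i => u _ (nodeClass_mem_classes i) ⟨i, self_mem_nodeClass i⟩
  have hcongr : ∀ μ ν hμ hν l hl hl', μ = ν → u μ hμ ⟨l, hl⟩ = u ν hν ⟨l, hl'⟩ := by
    rintro μ _ hμ hν l hl hl' rfl
    rfl
  have hw : ∀ i l (hl : l ∈ nodeClass A i), w l = u _ (nodeClass_mem_classes i) ⟨l, hl⟩ :=
    fun i l hl => hcongr _ _ _ _ _ _ _ (nodeClass_eq_of_mem hl)
  refine ⟨w, fun i => hupos _ _ _, fun i l hl => ?_, fun i => ?_⟩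
  · rw [hw i l hl]
    exact (mul_le_mulVec (block A _ _) _ ⟨i, self_mem_nodeClass i⟩ ⟨l, hl⟩).trans_eq
      (congrFun (hu _ (nodeClass_mem_classes i)) ⟨i, self_mem_nodeClass i⟩)
  · have := nonempty_of_mem_classes (nodeClass_mem_classes (A := A) i)
    obtain ⟨⟨l, hl⟩, hil⟩ := exists_mulVec_eq (block A _ _) (u _ (nodeClass_mem_classes i))
      ⟨i, self_mem_nodeClass i⟩
    refine ⟨l, hl, (hw i l hl).symm ▸ ?_⟩
    exact ((congrFun (hu _ _) _).symm.trans hil).le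

theorem IsClasswisePerron.mul {w g : ι → MaxAlg} (hw : IsClasswisePerron A w)
    (hg : ∀ i, 0 < g i) (hconst : ∀ i, ∀ l ∈ nodeClass A i, g l = g i) :
    IsClasswisePerron A (g * w) where
  pos i := mul_pos (hg i) (hw.pos i)
  mul_le i l hl := by
    simpa only [Pi.mul_apply, hconst i l hl, mul_left_comm _ (g i)]
      using mul_le_mul_right (hw.mul_le i l hl) (g i)
  exists_le i := by
    obtain ⟨l, hl, hle⟩ := hw.exists_le i
    refine ⟨l, hl, ?_⟩
    simpa only [Pi.mul_apply, hconst i l hl, mul_left_comm _ (g i)]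
      using mul_le_mul_right hle (g i)

theorem IsClasswisePerron.smul_indicator_le_mulVec {w : ι → MaxAlg} (hw : IsClasswisePerron A w)
    (q : ι) : perronRoot A (nodeClass A q) • (nodeClass A q).indicator w ≤
      A *ᵥ (nodeClass A q).indicator w := fun i => by
  by_cases hi : i ∈ nodeClass A q
  · obtain ⟨l, hl, hle⟩ := hw.exists_le i
    rw [nodeClass_eq_of_mem hi] at hl hle
    refine le_trans ?_ (mul_le_mulVec A _ i l)
    simpa only [Pi.smul_apply, smul_eq_mul, Set.indicator_of_mem hi, Set.indicator_of_mem hl]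
  · simp [Set.indicator_of_notMem hi]

/-- The classwise Perron vectors are rescaled by powers of a large constant, so that the edges
between different classes become negligible. -/
theorem exists_isClasswisePerron_mulVec_le (A : Matrix ι ι MaxAlg) (hc : c ≠ 0) :
    ∃ y, IsClasswisePerron A y ∧
      ∀ i, perronRoot A (nodeClass A i) ≤ c → (A *ᵥ y) i ≤ c * y i := by
  obtain ⟨w, hw⟩ := exists_isClasswisePerron A
  obtain ⟨b, hb⟩ := exists_le_smul_of_support_subset (v := (c⁻¹ • A) *ᵥ w) (x := w)
    fun i _ => (hw.pos i).ne'
  rw [inv_smul_mulVec_le_iff hc] at hb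
  have h1 : 1 ≤ b + 1 := le_add_self
  have hpow : ∀ k : ℕ, 0 < (b + 1) ^ k := fun k => pow_pos (zero_lt_one.trans_le h1) k
  refine ⟨fun i => (b + 1) ^ height A i * w i,
    hw.mul (fun i => hpow _) fun i l hl => ?_, fun i hi => mulVec_le_iff.2 fun l => ?_⟩
  · rw [le_antisymm (height_le hl.1) (height_le hl.2)]
  rcases (zero_le (a := A i l)).eq_or_lt with h0 | hil
  · rw [← h0, zero_mul]
    exact zero_le
  by_cases hli : NodeAccess A l i
  · have hl : l ∈ nodeClass A i := ⟨.of_pos hil, hli⟩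
    rw [le_antisymm (height_le hl.1) (height_le hl.2), mul_left_comm, mul_left_comm c]
    exact mul_le_mul_right ((hw.mul_le i l hl).trans (mul_le_mul_left hi _)) _
  · have hlt : height A l + 1 ≤ height A i :=
      not_le.1 fun h => hli (nodeAccess_of_height_le (.of_pos hil) h)
    calc A i l * ((b + 1) ^ height A l * w l)
        = (b + 1) ^ height A l * (A i l * w l) := mul_left_comm _ _ _
      _ ≤ (b + 1) ^ height A l * (c * ((b + 1) * w i)) := mul_le_mul_right
          (((mul_le_mulVec A w i l).trans (hb i)).trans
            (mul_le_mul_right (mul_le_mul_left le_self_add _) _)) _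
      _ = c * ((b + 1) ^ (height A l + 1) * w i) := by ring
      _ ≤ c * ((b + 1) ^ height A i * w i) :=
        mul_le_mul_right (mul_le_mul_left (pow_le_pow_right₀ h1 hlt) _) _

theorem exists_eigenvector_of_isInitial (hq : IsInitial A (nodeClass A q)) :
    ∃ v, v ≠ 0 ∧ A *ᵥ v = perronRoot A (nodeClass A q) • v := by
  obtain ⟨w, hw⟩ := exists_isClasswisePerron A
  refine ⟨(nodeClass A q).indicator w, fun h => (hw.pos q).ne' ?_,
    le_antisymm (fun i => mulVec_le_iff.2 fun l => ?_) (hw.smul_indicator_le_mulVec q)⟩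
  · rw [← Set.indicator_of_mem (self_mem_nodeClass q) w, h, Pi.zero_apply]
  rcases eq_or_ne (A i l * (nodeClass A q).indicator w l) 0 with h0 | hne
  · exact h0 ▸ zero_le
  have hl := Set.mem_of_indicator_ne_zero (right_ne_zero_of_mul hne)
  have hil : NodeAccess A i l := .of_pos (pos_iff_ne_zero.2 (left_ne_zero_of_mul hne))
  have hiq := hq.2 _ (access_nodeClass_iff.2 (hil.trans hl.2))
  have hi : i ∈ nodeClass A q := hiq ▸ self_mem_nodeClass i
  rw [Pi.smul_apply, Set.indicator_of_mem hl, Set.indicator_of_mem hi, ← hiq]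
  exact hw.mul_le i l (hiq ▸ hl)

theorem exists_eigenvector_of_perronRoot_le (hpos : 0 < perronRoot A (nodeClass A q))
    (hle : ∀ i, NodeAccess A i q → perronRoot A (nodeClass A i) ≤ perronRoot A (nodeClass A q)) :
    ∃ v, v ≠ 0 ∧ A *ᵥ v = perronRoot A (nodeClass A q) • v := by
  obtain ⟨y, hy, hAy⟩ := exists_isClasswisePerron_mulVec_le A hpos.ne'
  set x : ι → MaxAlg := {i | NodeAccess A i q}.indicator y with hx
  have hAx : A *ᵥ x ≤ perronRoot A (nodeClass A q) • x := fun i => mulVec_le_iff.2 fun l => by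
    rcases eq_or_ne (A i l * x l) 0 with h0 | hne
    · exact h0 ▸ zero_le
    have hl := Set.mem_of_indicator_ne_zero (right_ne_zero_of_mul hne)
    have hi : i ∈ {i | NodeAccess A i q} :=
      (NodeAccess.of_pos (pos_iff_ne_zero.2 (left_ne_zero_of_mul hne))).trans hl
    rw [hx, Pi.smul_apply, Set.indicator_of_mem hl, Set.indicator_of_mem hi]
    exact (mul_le_mulVec A y i l).trans (hAy i (hle i hi))
  obtain ⟨v, -, hv, hmax⟩ := exists_greatest_eigenvector_le hpos.ne' hAx
  have hyv := hmax _ (Set.indicator_le_indicator_of_subset (fun i hi => hi.2) fun _ => zero_le)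
    (hy.smul_indicator_le_mulVec q) q
  rw [Set.indicator_of_mem (self_mem_nodeClass q)] at hyv
  exact ⟨v, fun h0 => ((hy.pos q).trans_le hyv).ne' (congrFun h0 q), hv⟩

theorem exists_eigenvector_of_isSpectral {μ : Set ι} (hμ : IsSpectral A μ) :
    ∃ v, v ≠ 0 ∧ A *ᵥ v = perronRoot A μ • v := by
  obtain ⟨q, rfl⟩ := hμ.1
  rcases isSpectral_nodeClass_iff.1 hμ with hinit | ⟨hpos, hle⟩
  · exact exists_eigenvector_of_isInitial hinit
  · exact exists_eigenvector_of_perronRoot_le hpos hle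

theorem eigenvalues_eq_image (hdist : Set.InjOn (perronRoot A) (classes A)) :
    eigenvalues A = perronRoot A '' {μ | IsSpectral A μ} := by
  ext c
  constructor
  · rintro ⟨v, hv0, hv⟩
    obtain ⟨q, hq, rfl, -⟩ := exists_final_node hdist hv0 hv
    exact ⟨_, isSpectral_of_eigenvector hdist hv hq, rfl⟩
  · rintro ⟨μ, hμ, rfl⟩
    exact exists_eigenvector_of_isSpectral hμ

end Spectral

section Eval

variable {ι : Type*} [Fintype ι] [DecidableEq ι] {v : ι → MaxAlg}

theorem pow_mulVec_eq {A : Matrix ι ι MaxAlg} {c : MaxAlg} (h : A *ᵥ v = c • v) (k : ℕ) :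
    A ^ k *ᵥ v = c ^ k • v := by
  induction k with
  | zero => rw [pow_zero, pow_zero, Matrix.one_mulVec, one_smul]
  | succ k ih =>
    rw [pow_succ, ← Matrix.mulVec_mulVec, h, Matrix.mulVec_smul, ih, smul_smul, pow_succ, mul_comm]

variable {r : ℕ} {A : Fin r → Matrix ι ι MaxAlg}

theorem prod_ofFn_mulVec_eq {c : Fin r → MaxAlg} (h : ∀ k, A k *ᵥ v = c k • v) :
    (List.ofFn A).prod *ᵥ v = (∏ k, c k) • v := by
  induction r with
  | zero => rw [List.ofFn_zero, List.prod_nil, Matrix.one_mulVec, Fin.prod_univ_zero, one_smul]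
  | succ r ih =>
    rw [List.ofFn_succ, List.prod_cons, ← Matrix.mulVec_mulVec, ih fun k => h k.succ,
      Matrix.mulVec_smul, h, smul_smul, Fin.prod_univ_succ, mul_comm]

theorem evalMatrix_mulVec_eq (p : MvPolynomial (Fin r) MaxAlg) {c : Fin r → MaxAlg}
    (h : ∀ k, A k *ᵥ v = c k • v) : evalMatrix p A *ᵥ v = MvPolynomial.eval c p • v := by
  rw [evalMatrix, MvPolynomial.eval_eq', Matrix.sum_mulVec, Finset.sum_smul]
  refine Finset.sum_congr rfl fun d _ => ?_
  rw [Matrix.smul_mulVec, prod_ofFn_mulVec_eq fun k => pow_mulVec_eq (h k) (d k), smul_smul]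

theorem commute_evalMatrix (p : MvPolynomial (Fin r) MaxAlg) {B : Matrix ι ι MaxAlg}
    (hB : ∀ k, Commute B (A k)) : Commute B (evalMatrix p A) := by
  refine Commute.sum_right _ _ _ fun d _ => Commute.smul_right (Commute.list_prod_right _ _ ?_) _
  intro M hM
  obtain ⟨l, rfl⟩ := (List.mem_ofFn' _ _).1 hM
  exact (hB l).pow_right _

end Eval

section Family

variable {ι κ : Type*} [Fintype ι] {A : κ → Matrix ι ι MaxAlg}

theorem nodeAccess_eq (hcomm : ∀ i j, A i * A j = A j * A i)
    (hdist : ∀ i, Set.InjOn (perronRoot (A i)) (classes (A i))) (k l : κ) :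
    NodeAccess (A k) = NodeAccess (A l) :=
  nodeAccess_eq_of_edges (fun _ _ => nodeAccess_of_commute (hdist l) (hcomm l k))
    fun _ _ => nodeAccess_of_commute (hdist k) (hcomm k l)

/-- The final classes of the support of `v` are the same for all the matrices `A k`. -/
theorem exists_isSpectral_of_common_eigenvector [Nonempty κ]
    (hA : ∀ k l, NodeAccess (A k) = NodeAccess (A l))
    (hdist : ∀ i, Set.InjOn (perronRoot (A i)) (classes (A i))) {v : ι → MaxAlg} (hv0 : v ≠ 0)
    {b : κ → MaxAlg} (hv : ∀ k, A k *ᵥ v = b k • v) :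
    ∃ μ, ∀ k, IsSpectral (A k) μ ∧ perronRoot (A k) μ = b k := by
  choose q hq hroot hfinal using fun k => exists_final_node (hdist k) hv0 (hv k)
  inhabit κ
  refine ⟨nodeClass (A default) (q default), fun k => ?_⟩
  have hclass : nodeClass (A default) (q default) = nodeClass (A k) (q k) := by
    rw [nodeClass_congr (hA default k), nodeClass_eq_iff]
    exact ⟨hfinal k _ (hq default), hA default k ▸ hfinal default _ (hq k)⟩
  rw [hclass]
  exact ⟨isSpectral_of_eigenvector (hdist k) ((hroot k).symm ▸ hv k) (hq k), hroot k⟩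

variable [Finite κ]

theorem exists_common_eigenvector_of_isSpectral (hcomm : ∀ i j, A i * A j = A j * A i)
    (hdist : ∀ i, Set.InjOn (perronRoot (A i)) (classes (A i))) {k₀ : κ} {μ : Set ι}
    (hμ : IsSpectral (A k₀) μ) :
    ∃ v, v ≠ 0 ∧ ∀ k, IsSpectral (A k) μ ∧ A k *ᵥ v = perronRoot (A k) μ • v := by
  obtain ⟨w, hw0, hw⟩ := exists_eigenvector_of_isSpectral hμ
  obtain ⟨v, hvμ, hv0, b, hv⟩ := exists_common_eigenvector hcomm
    ((Submodule.ne_bot_iff _).2 ⟨w, hw, hw0⟩) isClosed_eigenspace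
    fun k _ => mulVec_mem_eigenspace (hcomm k₀ k)
  have : Nonempty κ := ⟨k₀⟩
  obtain ⟨ν, hν⟩ :=
    exists_isSpectral_of_common_eigenvector (nodeAccess_eq hcomm hdist) hdist hv0 hv
  obtain ⟨j, hj⟩ := Function.ne_iff.1 hv0
  have hb : b k₀ = perronRoot (A k₀) μ :=
    mul_right_cancel₀ hj (congrFun ((hv k₀).symm.trans hvμ) j)
  obtain rfl : ν = μ := hdist k₀ (hν k₀).1.1 hμ.1 ((hν k₀).2.trans hb)
  exact ⟨v, hv0, fun k => ⟨(hν k).1, (hν k).2.symm ▸ hv k⟩⟩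

theorem isSpectral_congr (hcomm : ∀ i j, A i * A j = A j * A i)
    (hdist : ∀ i, Set.InjOn (perronRoot (A i)) (classes (A i))) (k l : κ) :
    IsSpectral (A k) = IsSpectral (A l) := by
  have himp : ∀ i j μ, IsSpectral (A i) μ → IsSpectral (A j) μ := fun i j μ hμ =>
    let ⟨_, _, hv⟩ := exists_common_eigenvector_of_isSpectral hcomm hdist hμ
    (hv j).1
  exact funext fun μ => propext ⟨himp k l μ, himp l k μ⟩

theorem isSpectral_iff_isSpectral_sum [Fintype κ] (hcomm : ∀ i j, A i * A j = A j * A i)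
    (hdist : ∀ i, Set.InjOn (perronRoot (A i)) (classes (A i))) (k : κ) {μ : Set ι} :
    IsSpectral (A k) μ ↔ IsSpectral (∑ l, A l) μ := by
  have hA := nodeAccess_eq hcomm hdist
  have hS := nodeAccess_sum_eq hA
  have hroot : ∀ {ν}, ν ∈ classes (A k) → perronRoot (∑ l, A l) ν = ∑ l, perronRoot (A l) ν :=
    perronRoot_sum hcomm hA
  constructor
  · intro h
    have hspec : ∀ l, IsSpectral (A l) μ := fun l => isSpectral_congr hcomm hdist k l ▸ h
    rw [IsSpectral, classes_congr (hS k), isInitial_congr (hS k), access_congr (hS k), hroot h.1]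
    refine ⟨h.1, or_iff_not_imp_left.2 fun hinit => ?_⟩
    have hnon : ∀ l, 0 < perronRoot (A l) μ ∧
        ∀ ν, Access (A l) ν μ → perronRoot (A l) ν ≤ perronRoot (A l) μ := fun l =>
      (hspec l).2.resolve_left (isInitial_congr (hA k l) ▸ hinit)
    have hle : perronRoot (A k) μ ≤ ∑ l, perronRoot (A l) μ :=
      Finset.single_le_sum_of_canonicallyOrdered (f := fun l => perronRoot (A l) μ)
        (Finset.mem_univ k)
    refine ⟨(hnon k).1.trans_le hle, fun ν hν => ?_⟩
    rw [hroot hν.1]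
    exact Finset.sum_le_sum fun l _ => (hnon l).2 ν (access_congr (hA k l) ▸ hν)
  · intro h
    obtain ⟨m, -, hm⟩ := exists_sum_eq ⟨k, Finset.mem_univ k⟩ fun l => perronRoot (A l) μ
    rw [isSpectral_congr hcomm hdist k m]
    rw [IsSpectral, classes_congr (hS k), isInitial_congr (hS m), access_congr (hS m)] at h
    rw [hroot h.1, hm] at h
    refine ⟨classes_congr (hA k m) ▸ h.1, h.2.imp_right fun ⟨hpos, hle⟩ => ⟨hpos, fun ν hν => ?_⟩⟩
    have hνroot := hroot (classes_congr (hA m k) ▸ hν.1)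
    exact (sum_le_iff.1 hνroot.ge m (Finset.mem_univ m)).trans (hle ν hν)

theorem eigenvalues_evalMatrix [DecidableEq ι] {r : ℕ} [NeZero r] {A : Fin r → Matrix ι ι MaxAlg}
    (hcomm : ∀ i j, A i * A j = A j * A i)
    (hdist : ∀ i, Set.InjOn (perronRoot (A i)) (classes (A i)))
    (p : MvPolynomial (Fin r) MaxAlg) :
    eigenvalues (evalMatrix p A) = (fun μ => MvPolynomial.eval (fun i => perronRoot (A i) μ) p) ''
      {μ | ∀ i, IsSpectral (A i) μ} := by
  ext c
  constructor
  · rintro ⟨w, hw0, hw⟩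
    obtain ⟨v, hvp, hv0, b, hv⟩ := exists_common_eigenvector hcomm
      ((Submodule.ne_bot_iff _).2 ⟨w, hw, hw0⟩) isClosed_eigenspace
      fun k _ => mulVec_mem_eigenspace (commute_evalMatrix p fun l => hcomm k l).eq.symm
    obtain ⟨μ, hμ⟩ :=
      exists_isSpectral_of_common_eigenvector (nodeAccess_eq hcomm hdist) hdist hv0 hv
    obtain ⟨j, hj⟩ := Function.ne_iff.1 hv0
    have hb : MvPolynomial.eval b p = c :=
      mul_right_cancel₀ hj (congrFun ((evalMatrix_mulVec_eq p hv).symm.trans hvp) j)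
    exact ⟨μ, fun k => (hμ k).1, by simp only [(hμ _).2, hb]⟩
  · rintro ⟨μ, hμ, rfl⟩
    obtain ⟨v, hv0, hv⟩ := exists_common_eigenvector_of_isSpectral hcomm hdist (hμ 0)
    exact ⟨v, hv0, evalMatrix_mulVec_eq p fun k => (hv k).2⟩

end Family

theorem theoremt_general {ι : Type*} [Fintype ι] [DecidableEq ι] {r : ℕ} (hr : 1 ≤ r)
    {A : Fin r → Matrix ι ι MaxAlg} (hcomm : ∀ i j, A i * A j = A j * A i)
    (hdist : ∀ i, Set.InjOn (perronRoot (A i)) (classes (A i))) :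
    (∀ i, classes (A i) = classes (∑ k, A k)) ∧
    (∀ i μ ν, Access (A i) μ ν ↔ Access (∑ k, A k) μ ν) ∧
    ((∀ i μ, IsSpectral (A i) μ ↔ IsSpectral (∑ k, A k) μ) ∧
      (∀ i, (eigenvalues (A i)).Finite) ∧
      ∀ i j, (eigenvalues (A i)).ncard = (eigenvalues (A j)).ncard) ∧
    ∀ p : MvPolynomial (Fin r) MaxAlg,
      eigenvalues (evalMatrix p A) =
        (fun μ => MvPolynomial.eval (fun i => perronRoot (A i) μ) p) ''
          {μ | ∀ i, IsSpectral (A i) μ} := by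
  have hS := nodeAccess_sum_eq (nodeAccess_eq hcomm hdist)
  have : NeZero r := ⟨Nat.one_le_iff_ne_zero.1 hr⟩
  refine ⟨fun i => (classes_congr (hS i)).symm, fun i μ ν => by rw [access_congr (hS i)],
    ⟨fun i μ => isSpectral_iff_isSpectral_sum hcomm hdist i, fun i => ?_, fun i j => ?_⟩,
    eigenvalues_evalMatrix hcomm hdist⟩
  · rw [eigenvalues_eq_image (hdist i)]
    exact (Set.toFinite _).image _
  · have hinj : ∀ k, Set.InjOn (perronRoot (A k)) {μ | IsSpectral (A k) μ} := fun k =>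
      (hdist k).mono fun _ h => h.1
    rw [eigenvalues_eq_image (hdist i), eigenvalues_eq_image (hdist j), (hinj i).ncard_image,
      (hinj j).ncard_image, isSpectral_congr hcomm hdist i j]

end

end MaxAlg

theorem theoremt (n r : ℕ) (hr : 1 ≤ r) (A : Fin r → Matrix (Fin n) (Fin n) MaxAlg)
    (hcomm : ∀ i j, A i * A j = A j * A i)
    (hdist : ∀ i, Set.InjOn (MaxAlg.perronRoot (A i)) (MaxAlg.classes (A i))) :
    (∀ i, MaxAlg.classes (A i) = MaxAlg.classes (∑ k, A k)) ∧
    (∀ i μ ν, MaxAlg.Access (A i) μ ν ↔ MaxAlg.Access (∑ k, A k) μ ν) ∧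
    ((∀ i μ, MaxAlg.IsSpectral (A i) μ ↔ MaxAlg.IsSpectral (∑ k, A k) μ) ∧
      (∀ i, (MaxAlg.eigenvalues (A i)).Finite) ∧
      ∀ i j, (MaxAlg.eigenvalues (A i)).ncard = (MaxAlg.eigenvalues (A j)).ncard) ∧
    ∀ p : MvPolynomial (Fin r) MaxAlg,
      MaxAlg.eigenvalues (MaxAlg.evalMatrix p A) =
        (fun μ : Set (Fin n) => MvPolynomial.eval (fun i => MaxAlg.perronRoot (A i) μ) p) ''
          {μ | ∀ i, MaxAlg.IsSpectral (A i) μ} :=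
  MaxAlg.theoremt_general hr hcomm hdist
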